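/- \textbf{Setting.} Let $N\ge 2$ senders each receive an independent uniform bit $x_i\in\{0,1\}$ and send a message to a receiver, who outputs $z\in\{0,1\}^N$; the success metric is $\widetilde{\mathcal S}=1-\sum_{x\in\{0,1\}^N}2^{-N}\,p(z=x\mid x)$. In the classical setting each sender encodes independently by $p_i(m_i\mid x_i)$ (finite message alphabets), the receiver decodes by $p_d(z\mid m_1,\dots,m_N)$, and the anti-distinguishability of sender $i$ is $1-\sum_{m}\min_{x}\tfrac12 p_i(m\mid x)$. Let $A^C$ be the least $A$ such that some classical strategy in which every sender has anti-distinguishability at most $A$ attains $\widetilde{\mathcal S}=1$. In the PBR-based (Pusey--Barrett--Rudolph) protocol with angle $\theta\in(0,\pi/2)$, each sender sends the qubit state $|\psi_{x_i}\rangle=\cos(\theta/2)|0\rangle+(-1)^{x_i}\sin(\theta/2)|1\rangle$, and the receiver applies to the $N$ qubits the phase gate $|0\rangle\langle0|+e^{i\beta}|1\rangle\langle1|$ on each qubit, then the gate multiplying $|0\cdots0\rangle$ by $e^{i\alpha}$ and fixing the other computational basis vectors, then a Hadamard gate on each qubit, and measures in the computational basis. The angle $\theta$ is called admissible if for some real $\alpha,\beta$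 this attains $\widetilde{\mathcal S}=1$. Let $A^Q=A^Q(\theta)=1-\min_M\sum_z\min_{x}\tfrac12\langle\psi_x|M_z|\psi_x\rangle$, the minimum being over all measurements (POVMs) $M$ on one qubit with finitely many outcomes. The advantage is $(A^C/A^Q)^N$. \textbf{Corollary (optimal PBR-based advantage).} For every $N\ge2$ the admissible angles are exactly those with $2\tan^{-1}(2^{1/N}-1)\le\theta<\pi/2$. Among them the advantage is maximised at, and only at, $\theta_N=2\tan^{-1}(2^{1/N}-1)$, where $$\left(\frac{A^C}{A^Q}\right)^N=2^N\left(1+2^{1-\frac2N}-2^{1-\frac1N}\right)^N .$$ As $N\to\infty$, with $\theta=\theta_N$, one has $A^C/A^Q\to2$, and $(A^C/A^Q)^N$ grows like $2^N$: it is $\Theta(2^N)$, and more precisely $(A^C/A^Q)^N/2^N\to\tfrac14$. -/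

import Mathlib

namespace DistributedAnti

/-- A conditional probability distribution `p(b | a)`, written `p a b`. -/
def IsChannel {A B : Type} [Fintype B] (p : A → B → ℝ) : Prop :=
  (∀ a b, 0 ≤ p a b) ∧ ∀ a, ∑ b, p a b = 1

/-- The uniform prior on the two inputs of a sender. -/
noncomputable def unif : Fin 2 → ℝ := fun _ => 1 / 2

/-- Success metric of anti-distinguishing distributed inputs,
`1 - ∑_x q_x p(z = x | x)` with product prior `q_x = ∏ i, q (x i)`;
`p x z` is the probability of the receiver's outcome `z` on the input tuple `x`. -/
noncomputable def successMetric {N : ℕ} {X : Type} [Fintype X] (q : X → ℝ)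
    (p : (Fin N → X) → (Fin N → X) → ℝ) : ℝ :=
  1 - ∑ x : Fin N → X, (∏ i, q (x i)) * p x x

section Classical

/-- Anti-distinguishability of a classical encoding `e x m = p_e(m | x)`:
`1 - ∑_m min_x q_x p_e(m | x)`. -/
noncomputable def classicalAntiDist {X M : Type} [Fintype M] (q : X → ℝ)
    (e : X → M → ℝ) : ℝ :=
  1 - ∑ m, ⨅ x, q x * e x m

/-- The classical correlation produced by independent encodings `e i` and a decoding `D`. -/
noncomputable def classicalCorrelation {N : ℕ} {X : Type} {d : Fin N → ℕ}
    (e : ∀ i, X → Fin (d i) → ℝ) (D : (∀ i, Fin (d i)) → (Fin N → X) → ℝ) :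
    (Fin N → X) → (Fin N → X) → ℝ :=
  fun x z => ∑ m : (∀ i, Fin (d i)), D m z * ∏ i, e i (x i) (m i)

/-- With `N` senders, binary equiprobable inputs, and the anti-distinguishability of every
sender's messages bounded by `A`, some classical strategy attains success metric `1`. -/
def ClassicallyPerfect (N : ℕ) (A : ℝ) : Prop :=
  ∃ (d : Fin N → ℕ) (e : ∀ i, Fin 2 → Fin (d i) → ℝ)
    (D : (∀ i, Fin (d i)) → (Fin N → Fin 2) → ℝ),
    (∀ i, IsChannel (e i)) ∧ IsChannel D ∧
    (∀ i, classicalAntiDist unif (e i) ≤ A) ∧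
    successMetric unif (classicalCorrelation e D) = 1

/-- `A^C`: the anti-distinguishability of each sender's inputs that classical communication
requires for success metric `1`. -/
noncomputable def requiredClassical (N : ℕ) : ℝ :=
  sInf {A : ℝ | ClassicallyPerfect N A}

end Classical

section Quantum

open scoped ComplexOrder

/-- A measurement (POVM) with outcomes `Z` on the Hilbert space with orthonormal basis `d`. -/
def IsPOVM {d Z : Type} [Fintype d] [DecidableEq d] [Fintype Z]
    (M : Z → Matrix d d ℂ) : Prop :=
  (∀ z, (M z).PosSemidef) ∧ ∑ z, M z = 1

/-- The Born rule `Tr(ρ M)`. -/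
noncomputable def born {d : Type} [Fintype d] (ρ M : Matrix d d ℂ) : ℝ :=
  (ρ * M).trace.re

/-- Anti-distinguishability of a family of quantum states with prior `q`:
`1 - min_M ∑_z min_x q_x Tr(ρ_x M_z)` over all measurements with finitely many outcomes. -/
noncomputable def quantumAntiDist {X d : Type} [Fintype d] [DecidableEq d]
    (q : X → ℝ) (ρ : X → Matrix d d ℂ) : ℝ :=
  1 - sInf {r : ℝ | ∃ (k : ℕ) (M : Fin k → Matrix d d ℂ),
    IsPOVM M ∧ r = ∑ z, ⨅ x, q x * born (ρ x) (M z)}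

/-- The tensor product `A 0 ⊗ ⋯ ⊗ A (N - 1)`, in the product basis. -/
noncomputable def tensor {N : ℕ} {d : Type} (A : Fin N → Matrix d d ℂ) :
    Matrix (Fin N → d) (Fin N → d) ℂ :=
  Matrix.of fun k l => ∏ i, A i (k i) (l i)

/-- The correlation `p(z | x) = Tr((ρ_{x_1} ⊗ ⋯ ⊗ ρ_{x_N}) M_z)`. -/
noncomputable def quantumCorrelation {N : ℕ} {X d : Type} [Fintype d]
    (ρ : X → Matrix d d ℂ) (M : (Fin N → X) → Matrix (Fin N → d) (Fin N → d) ℂ) :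
    (Fin N → X) → (Fin N → X) → ℝ :=
  fun x z => born (tensor fun i => ρ (x i)) (M z)

end Quantum

section PBR

/-- The vector `cos(θ/2) |0⟩ + (-1)^x sin(θ/2) |1⟩`. -/
noncomputable def pbrKet (θ : ℝ) (x : Fin 2) : Fin 2 → ℂ :=
  ![(Real.cos (θ / 2) : ℂ), (-1) ^ (x : ℕ) * (Real.sin (θ / 2) : ℂ)]

/-- The pure state `|ψ_x⟩⟨ψ_x|` a sender transmits on input `x`. -/
noncomputable def pbrState (θ : ℝ) (x : Fin 2) : Matrix (Fin 2) (Fin 2) ℂ :=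
  Matrix.vecMulVec (pbrKet θ x) (star (pbrKet θ x))

/-- The Hadamard gate. -/
noncomputable def hadamard : Matrix (Fin 2) (Fin 2) ℂ :=
  ((1 / Real.sqrt 2 : ℝ) : ℂ) • !![1, 1; 1, -1]

/-- The gate `|0⟩⟨0| + e^{iβ} |1⟩⟨1|`. -/
noncomputable def phaseGate (β : ℝ) : Matrix (Fin 2) (Fin 2) ℂ :=
  !![1, 0; 0, Complex.exp (β * Complex.I)]

/-- The `N`-qubit gate that multiplies `|0⋯0⟩` by `e^{iα}` and fixes the other basis vectors. -/
noncomputable def zeroPhaseGate (N : ℕ) (α : ℝ) :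
    Matrix (Fin N → Fin 2) (Fin N → Fin 2) ℂ :=
  Matrix.diagonal fun k => if k = 0 then Complex.exp (α * Complex.I) else 1

/-- The Pusey–Barrett–Rudolph circuit: a phase gate on every qubit, then the phase on
`|0⋯0⟩`, then a Hadamard gate on every qubit. -/
noncomputable def pbrCircuit (N : ℕ) (α β : ℝ) :
    Matrix (Fin N → Fin 2) (Fin N → Fin 2) ℂ :=
  tensor (fun _ => hadamard) * zeroPhaseGate N α * tensor (fun _ => phaseGate β)

/-- The Pusey–Barrett–Rudolph measurement: run the circuit, then measure in the
computational basis. -/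
noncomputable def pbrMeasurement (N : ℕ) (α β : ℝ) (z : Fin N → Fin 2) :
    Matrix (Fin N → Fin 2) (Fin N → Fin 2) ℂ :=
  (pbrCircuit N α β).conjTranspose * Matrix.single z z 1 * pbrCircuit N α β

/-- The angles `0 < θ < π/2` for which the PBR-based protocol works: for suitable circuit
parameters, the PBR measurement anti-distinguishes the `2^N` product states perfectly. -/
def pbrAngles (N : ℕ) : Set ℝ :=
  {θ | 0 < θ ∧ θ < Real.pi / 2 ∧ ∃ α β : ℝ, IsPOVM (pbrMeasurement N α β) ∧
    successMetric unif (quantumCorrelation (pbrState θ) (pbrMeasurement N α β)) = 1}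

/-- `A^Q`: the anti-distinguishability of each sender's inputs in the PBR-based protocol. -/
noncomputable def pbrQuantum (θ : ℝ) : ℝ :=
  quantumAntiDist unif (pbrState θ)

/-- The quantum advantage `(A^C / A^Q)^N` of the PBR-based protocol. -/
noncomputable def pbrAdvantage (N : ℕ) (θ : ℝ) : ℝ :=
  (requiredClassical N / pbrQuantum θ) ^ N

/-- The angle `2 arctan(2^{1/N} - 1)`. -/
noncomputable def optAngle (N : ℕ) : ℝ :=
  2 * Real.arctan ((2 : ℝ) ^ (1 / (N : ℝ)) - 1)

end PBR

end DistributedAnti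

namespace DistributedAnti

/-! ### The classical requirement -/

section Classical

/-! Everything reduces to one inequality and one monotonicity. Classically `A^C = 1`: a sender with
anti-distinguishability below 1 has a message possible under both inputs, and if every sender emits
such a message, any answer the receiver gives is wrong for some input that could have produced it.
Quantumly `A^Q = (1 + sin θ)/2` by Helstrom, so the advantage strictly decreases in `θ` and is
optimal only at the smallest admissible angle.

Write `c = cos(θ/2)`, `s = sin(θ/2)`. The amplitude of the outcome `z = x` is, up to a nonzero
factor, `(c + e^{iβ} s)^N + (e^{iα} - 1) c^N` for every `x`. It vanishes for some `α` iff `|(c +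
e^{iβ} s)^N - c^N| = c^N`. The left side is at most `(c + s)^N - c^N`, and continuity in `β` gives
the converse (`exists_phases_iff`), so admissibility means `2 c^N ≤ (c + s)^N`, that is `tan(θ/2) ≥
2^{1/N} - 1`.

At the optimum `A^C/A^Q = 2(1 + ε)` with `Nε → -2 log 2`, whence the limit `exp(-2 log 2) = 1/4`. -/

theorem iInf_fin_two (f : Fin 2 → ℝ) : ⨅ x, f x = min (f 0) (f 1) := by
  apply le_antisymm
  · exact le_min (ciInf_le (Set.finite_range f).bddBelow 0)
      (ciInf_le (Set.finite_range f).bddBelow 1)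
  · exact le_ciInf (Fin.forall_fin_two.2 ⟨min_le_left _ _, min_le_right _ _⟩)

/-- The success metric is `1` exactly when no input tuple is ever guessed. -/
theorem successMetric_unif_eq_one_iff {N : ℕ} {p : (Fin N → Fin 2) → (Fin N → Fin 2) → ℝ}
    (hp : ∀ x, 0 ≤ p x x) : successMetric unif p = 1 ↔ ∀ x, p x x = 0 := by
  have hw : ∀ x : Fin N → Fin 2, 0 < ∏ i, unif (x i) := fun x =>
    Finset.prod_pos fun i _ => by norm_num [unif]
  unfold successMetric
  rw [sub_eq_self, Finset.sum_eq_zero_iff_of_nonneg fun x _ => mul_nonneg (hw x).le (hp x)]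
  simp [(hw _).ne']

theorem exists_pos_of_classicalAntiDist_lt_one {k : ℕ} {e : Fin 2 → Fin k → ℝ}
    (h : classicalAntiDist unif e < 1) : ∃ m, ∀ x, 0 < e x m := by
  have hs : 0 < ∑ m, ⨅ x, unif x * e x m := by
    unfold classicalAntiDist at h
    linarith
  obtain ⟨m, -, hm⟩ := Finset.exists_lt_of_sum_lt (s := Finset.univ) (f := fun _ : Fin k => (0 : ℝ))
    (by simpa using hs)
  rw [iInf_fin_two, lt_min_iff] at hm
  norm_num [unif] at hm
  exact ⟨m, Fin.forall_fin_two.2 hm⟩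

theorem ClassicallyPerfect.one_le {N : ℕ} {A : ℝ} (h : ClassicallyPerfect N A) : 1 ≤ A := by
  obtain ⟨d, e, D, he, hD, hA, hS⟩ := h
  by_contra! hA1
  choose m hm using fun i => exists_pos_of_classicalAntiDist_lt_one ((hA i).trans_lt hA1)
  have hnn : ∀ (x : Fin N → Fin 2) (k : ∀ i, Fin (d i)), 0 ≤ D k x * ∏ i, e i (x i) (k i) :=
    fun x k => mul_nonneg (hD.1 _ _) (Finset.prod_nonneg fun i _ => (he i).1 _ _)
  have h0 := (successMetric_unif_eq_one_iff fun x =>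
    Finset.sum_nonneg fun k _ => hnn x k).1 hS
  -- On input `z` the ambiguous tuple `m` has positive probability, so perfection forbids answering
  -- `z` to it; no answer is left.
  have hz : ∀ z, D m z = 0 := fun z => by
    have h1 := (Finset.sum_eq_zero_iff_of_nonneg fun k _ => hnn z k).1 (h0 z) m
      (Finset.mem_univ _)
    exact (mul_eq_zero.1 h1).resolve_right (Finset.prod_pos fun i _ => hm i _).ne'
  simpa [hz] using hD.2 m

theorem classicallyPerfect_one {N : ℕ} (hN : N ≠ 0) : ClassicallyPerfect N 1 := by
  -- Each sender transmits its bit and the receiver flips them all. The guess is already wrong at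
  -- coordinate 0, which exists because `N ≠ 0`.
  refine ⟨fun _ => 2, fun _ x m => if m = x then 1 else 0,
    fun m z => if z = m + 1 then 1 else 0, fun i => ⟨fun a b => ?_, fun a => by simp⟩,
    ⟨fun a b => ?_, fun a => by simp⟩, fun i => ?_, ?_⟩
  · dsimp only
    split_ifs <;> simp
  · dsimp only
    split_ifs <;> simp
  · simp [classicalAntiDist, iInf_fin_two, unif, Fin.sum_univ_two]
  · have h0 : ∀ x : Fin N → Fin 2, classicalCorrelation
        (fun (_ : Fin N) (x m : Fin 2) => if m = x then (1 : ℝ) else 0)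
        (fun m z => if z = m + 1 then 1 else 0) x x = 0 := fun x => by
      refine Finset.sum_eq_zero fun m _ => ?_
      by_cases hx : x = m + 1
      · refine mul_eq_zero_of_right _ (Finset.prod_eq_zero
          (Finset.mem_univ ⟨0, Nat.pos_of_ne_zero hN⟩) ?_)
        subst hx
        simp
      · simp [hx]
    exact (successMetric_unif_eq_one_iff fun x => (h0 x).ge).2 h0

/-- Perfect classical strategies require perfectly distinguishable messages. -/
theorem requiredClassical_eq_one {N : ℕ} (hN : N ≠ 0) : requiredClassical N = 1 :=
  IsLeast.csInf_eq ⟨classicallyPerfect_one hN, fun _ h => ClassicallyPerfect.one_le h⟩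

end Classical

/-! ### Helstrom's formula for one qubit -/

section SingleQubit

open scoped ComplexOrder

theorem born_pbrState (θ : ℝ) (x : Fin 2) {M : Matrix (Fin 2) (Fin 2) ℂ} (hM : M.IsHermitian) :
    born (pbrState θ x) M = Real.cos (θ / 2) ^ 2 * (M 0 0).re
      + Real.sin (θ / 2) ^ 2 * (M 1 1).re + (-1) ^ (x : ℕ) * (Real.sin θ * (M 0 1).re) := by
  have h10 : (M 1 0).re = (M 0 1).re := by rw [← hM.apply 1 0]; simp
  have hs : Real.sin θ = 2 * Real.sin (θ / 2) * Real.cos (θ / 2) := by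
    rw [← Real.sin_two_mul]; ring_nf
  rw [hs]
  simp only [born, pbrState, Matrix.trace, Matrix.diag_apply, Matrix.mul_apply,
    Fin.sum_univ_two, Matrix.vecMulVec_apply, pbrKet, Pi.star_apply]
  generalize Real.cos (θ / 2) = c
  generalize Real.sin (θ / 2) = s
  fin_cases x <;>
  · simp [h10]
    ring

theorem iInf_unif_mul_born_pbrState (θ : ℝ) {M : Matrix (Fin 2) (Fin 2) ℂ}
    (hM : M.IsHermitian) :
    ⨅ x, unif x * born (pbrState θ x) M = (Real.cos (θ / 2) ^ 2 * (M 0 0).re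
      + Real.sin (θ / 2) ^ 2 * (M 1 1).re - |Real.sin θ * (M 0 1).re|) / 2 := by
  rw [iInf_fin_two, born_pbrState θ 0 hM, born_pbrState θ 1 hM]
  simp only [unif, Fin.val_zero, Fin.val_one, pow_zero, pow_one, one_mul, neg_one_mul]
  rcases abs_cases (Real.sin θ * (M 0 1).re) with ⟨h, h'⟩ | ⟨h, h'⟩
  · rw [h, min_eq_right] <;> linarith
  · rw [h, min_eq_left] <;> linarith

/-- Positivity is tested on the vectors `(1, 1)` and `(1, -1)`. This bounds the interference term of
any outcome by its trace, with equality for `plusMinus`. -/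
theorem two_mul_abs_re_le {M : Matrix (Fin 2) (Fin 2) ℂ} (hM : M.PosSemidef) :
    2 * |(M 0 1).re| ≤ (M 0 0).re + (M 1 1).re := by
  have h10 : (M 1 0).re = (M 0 1).re := by rw [← hM.1.apply 1 0]; simp
  have h1 := (Complex.le_def.1 (hM.dotProduct_mulVec_nonneg ![1, 1])).1
  have h2 := (Complex.le_def.1 (hM.dotProduct_mulVec_nonneg ![1, -1])).1
  simp [dotProduct, Matrix.mulVec, Fin.sum_univ_two, h10] at h1 h2
  rcases abs_cases (M 0 1).re with ⟨h, -⟩ | ⟨h, -⟩ <;> rw [h] <;> linarith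

/-- The measurement in the eigenbasis of the Pauli operator `X`. -/
noncomputable def plusMinus : Fin 2 → Matrix (Fin 2) (Fin 2) ℂ :=
  fun z => (1 / 2 : ℂ) • Matrix.vecMulVec ![1, (-1) ^ (z : ℕ)] (star ![1, (-1) ^ (z : ℕ)])

theorem isPOVM_plusMinus : IsPOVM plusMinus := by
  have h2 : (0 : ℂ) ≤ 1 / 2 := by rw [Complex.le_def]; norm_num
  refine ⟨fun z => (Matrix.posSemidef_vecMulVec_self_star _).smul h2, ?_⟩
  ext i j
  simp only [plusMinus, Fin.sum_univ_two, Matrix.add_apply, Matrix.smul_apply,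
    Matrix.vecMulVec_apply, Pi.star_apply]
  fin_cases i <;> fin_cases j <;> norm_num

/-- Helstrom's formula for the two states of the protocol. -/
theorem pbrQuantum_eq {θ : ℝ} (h0 : 0 ≤ Real.sin θ) : pbrQuantum θ = (1 + Real.sin θ) / 2 := by
  have hcs := Real.cos_sq_add_sin_sq (θ / 2)
  suffices h : IsLeast {r : ℝ | ∃ (k : ℕ) (M : Fin k → Matrix (Fin 2) (Fin 2) ℂ),
      IsPOVM M ∧ r = ∑ z, ⨅ x, unif x * born (pbrState θ x) (M z)} ((1 - Real.sin θ) / 2) by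
    rw [pbrQuantum, quantumAntiDist, h.csInf_eq]
    ring
  refine ⟨⟨2, plusMinus, isPOVM_plusMinus, ?_⟩, ?_⟩
  · have hH : ∀ z, (plusMinus z).IsHermitian := fun z => (isPOVM_plusMinus.1 z).1
    simp only [iInf_unif_mul_born_pbrState θ (hH _), Fin.sum_univ_two, abs_mul, abs_of_nonneg h0]
    simp only [plusMinus, Matrix.smul_apply, Matrix.vecMulVec_apply, Pi.star_apply]
    norm_num
    linarith
  · rintro r ⟨k, M, hM, rfl⟩
    have hsum : ∀ i, ∑ z, (M z i i).re = 1 := fun i => by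
      have := congrArg (fun A : Matrix (Fin 2) (Fin 2) ℂ => (A i i).re) hM.2
      simpa [Matrix.sum_apply] using this
    -- Replacing each `|Re M₀₁|` by half the trace of `M z` gives a bound linear in `M`, whose sum
    -- is fixed by completeness.
    calc (1 - Real.sin θ) / 2
        = ∑ z, (Real.cos (θ / 2) ^ 2 * (M z 0 0).re + Real.sin (θ / 2) ^ 2 * (M z 1 1).re
            - Real.sin θ * (((M z 0 0).re + (M z 1 1).re) / 2)) / 2 := by
          rw [← Finset.sum_div, Finset.sum_sub_distrib, Finset.sum_add_distrib,
            ← Finset.mul_sum, ← Finset.mul_sum, ← Finset.mul_sum, ← Finset.sum_div,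
            Finset.sum_add_distrib, hsum, hsum]
          linarith
      _ ≤ _ := by
          refine Finset.sum_le_sum fun z _ => ?_
          rw [iInf_unif_mul_born_pbrState θ (hM.1 z).1, abs_mul, abs_of_nonneg h0]
          have := two_mul_abs_re_le (hM.1 z)
          gcongr
          linarith

end SingleQubit

/-! ### The circuit and its amplitudes -/

section Circuit

open scoped ComplexOrder Matrix

theorem tensor_mulVec {N : ℕ} (A : Fin N → Matrix (Fin 2) (Fin 2) ℂ) (v : Fin N → Fin 2 → ℂ) :
    tensor A *ᵥ (fun k => ∏ i, v i (k i)) = fun k => ∏ i, (A i *ᵥ v i) (k i) := by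
  ext k
  simp only [Matrix.mulVec, dotProduct, tensor, Matrix.of_apply, ← Finset.prod_mul_distrib]
  rw [Finset.prod_univ_sum]
  simp [Fintype.piFinset_univ]

theorem tensor_mul {N : ℕ} (A B : Fin N → Matrix (Fin 2) (Fin 2) ℂ) :
    tensor A * tensor B = tensor fun i => A i * B i := by
  ext k l
  simp only [Matrix.mul_apply, tensor, Matrix.of_apply, ← Finset.prod_mul_distrib]
  rw [Finset.prod_univ_sum]
  simp [Fintype.piFinset_univ]

theorem conjTranspose_tensor {N : ℕ} (A : Fin N → Matrix (Fin 2) (Fin 2) ℂ) :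
    (tensor A)ᴴ = tensor fun i => (A i)ᴴ := by
  ext k l
  simp [tensor, Matrix.conjTranspose_apply]

theorem tensor_one {N : ℕ} :
    tensor (fun _ : Fin N => (1 : Matrix (Fin 2) (Fin 2) ℂ)) = 1 := by
  ext k l
  simp only [tensor, Matrix.of_apply, Matrix.one_apply]
  split_ifs with h
  · simp [h]
  · obtain ⟨i, hi⟩ := Function.ne_iff.1 h
    exact Finset.prod_eq_zero (Finset.mem_univ i) (by simp [hi])

theorem conj_exp_mul_exp (t : ℝ) :
    (starRingEnd ℂ) (Complex.exp (t * Complex.I)) * Complex.exp (t * Complex.I) = 1 := by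
  rw [← Complex.exp_conj, ← Complex.exp_add]
  simp

theorem ofReal_sqrt_two_mul_self : (Real.sqrt 2 : ℂ) * Real.sqrt 2 = 2 := by
  rw [← Complex.ofReal_mul, Real.mul_self_sqrt (by norm_num)]
  simp

theorem hadamard_unitary : hadamardᴴ * hadamard = 1 := by
  have h : ((Real.sqrt 2 : ℝ) : ℂ)⁻¹ * (Real.sqrt 2 : ℂ)⁻¹ = 1 / 2 := by
    rw [← mul_inv, ofReal_sqrt_two_mul_self, one_div]
  ext i j
  fin_cases i <;> fin_cases j <;>
    norm_num [hadamard, Matrix.mul_apply, Fin.sum_univ_two, Matrix.conjTranspose_apply, h]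

theorem phaseGate_unitary (β : ℝ) : (phaseGate β)ᴴ * phaseGate β = 1 := by
  ext i j
  fin_cases i <;> fin_cases j <;>
    simp [phaseGate, Matrix.mul_apply, Fin.sum_univ_two, conj_exp_mul_exp]

theorem zeroPhaseGate_unitary (N : ℕ) (α : ℝ) :
    (zeroPhaseGate N α)ᴴ * zeroPhaseGate N α = 1 := by
  rw [zeroPhaseGate, Matrix.diagonal_conjTranspose, Matrix.diagonal_mul_diagonal,
    ← Matrix.diagonal_one]
  congr 1
  ext k
  simp only [Pi.star_apply]
  split_ifs
  · exact conj_exp_mul_exp α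
  · simp

theorem pbrCircuit_unitary (N : ℕ) (α β : ℝ) :
    (pbrCircuit N α β)ᴴ * pbrCircuit N α β = 1 := by
  have hH : (tensor fun _ : Fin N => hadamard)ᴴ * (tensor fun _ : Fin N => hadamard) = 1 := by
    simp only [conjTranspose_tensor, tensor_mul, hadamard_unitary, tensor_one]
  have hP : (tensor fun _ : Fin N => phaseGate β)ᴴ * (tensor fun _ : Fin N => phaseGate β) = 1 := by
    simp only [conjTranspose_tensor, tensor_mul, phaseGate_unitary, tensor_one]
  calc (pbrCircuit N α β)ᴴ * pbrCircuit N α β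
      = (tensor fun _ : Fin N => phaseGate β)ᴴ * ((zeroPhaseGate N α)ᴴ *
          ((tensor fun _ : Fin N => hadamard)ᴴ * (tensor fun _ : Fin N => hadamard)) *
          zeroPhaseGate N α) * (tensor fun _ : Fin N => phaseGate β) := by
        simp only [pbrCircuit, Matrix.conjTranspose_mul, Matrix.mul_assoc]
    _ = 1 := by rw [hH, mul_one, zeroPhaseGate_unitary, mul_one, hP]

theorem isPOVM_pbrMeasurement (N : ℕ) (α β : ℝ) : IsPOVM (pbrMeasurement N α β) := by
  refine ⟨fun z => ?_, ?_⟩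
  · refine Matrix.PosSemidef.conjTranspose_mul_mul_same ?_ _
    rw [← Matrix.diagonal_single]
    refine Matrix.PosSemidef.diagonal fun i => ?_
    by_cases h : i = z
    · subst h; simp
    · simp [h]
  · simp only [pbrMeasurement, ← Matrix.sum_mul, ← Matrix.mul_sum]
    rw [Matrix.sum_single_one, mul_one, pbrCircuit_unitary]

theorem tensor_pbrState {N : ℕ} (θ : ℝ) (x : Fin N → Fin 2) :
    tensor (fun i => pbrState θ (x i)) = Matrix.vecMulVec (fun k => ∏ i, pbrKet θ (x i) (k i))
      (star fun k => ∏ i, pbrKet θ (x i) (k i)) := by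
  ext k l
  simp [tensor, pbrState, Matrix.vecMulVec_apply, Finset.prod_mul_distrib]

/-- The Born rule for a pure state and a rank-one projector behind a circuit. -/
theorem born_vecMulVec {d : Type} [Fintype d] [DecidableEq d] (v : d → ℂ) (U : Matrix d d ℂ)
    (z : d) : born (Matrix.vecMulVec v (star v)) (Uᴴ * Matrix.single z z 1 * U)
      = Complex.normSq ((U *ᵥ v) z) := by
  have h : Uᴴ * Matrix.single z z 1 * U = Matrix.vecMulVec (star (U.row z)) (U.row z) := by
    ext i j
    simp [Matrix.mul_apply, Matrix.single_apply, Matrix.vecMulVec_apply, ite_and]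
  rw [born, h, Matrix.vecMulVec_mul_vecMulVec, Matrix.trace_vecMulVec, dotProduct_smul]
  have h1 : (U *ᵥ v) z = v ⬝ᵥ U.row z := by
    rw [dotProduct_comm]; rfl
  have h2 : star v ⬝ᵥ star (U.row z) = star (v ⬝ᵥ U.row z) := by
    rw [Matrix.star_dotProduct_star, dotProduct_comm]
  rw [h1, h2, smul_eq_mul, ← Complex.ofReal_re (Complex.normSq _), Complex.normSq_eq_conj_mul_self]
  rfl

/-- The amplitude for guessing the input tuple does not depend on that tuple. -/
theorem pbrCircuit_mulVec_apply {N : ℕ} (θ α β : ℝ) (x : Fin N → Fin 2) :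
    (pbrCircuit N α β *ᵥ fun k => ∏ i, pbrKet θ (x i) (k i)) x =
      ((1 / Real.sqrt 2 : ℝ) : ℂ) ^ N *
        ((Real.cos (θ / 2) + Complex.exp (β * Complex.I) * Real.sin (θ / 2)) ^ N
          + (Complex.exp (α * Complex.I) - 1) * Real.cos (θ / 2) ^ N) := by
  set w : Fin N → Fin 2 → ℂ := fun i => phaseGate β *ᵥ pbrKet θ (x i) with hw
  have hw0 : ∀ i, w i 0 = Real.cos (θ / 2) := fun i => by
    simp [w, phaseGate, pbrKet]
  have hw1 : ∀ i, w i 1 = Complex.exp (β * Complex.I) *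
      ((-1) ^ (x i : ℕ) * Real.sin (θ / 2)) := fun i => by
    simp [w, phaseGate, pbrKet, mul_comm]
  -- The gate alters only the `|0⋯0⟩` coefficient `c^N`, so its output is a sum of two product
  -- vectors, on which the Hadamards act factorwise.
  have hsplit : zeroPhaseGate N α *ᵥ (fun k => ∏ i, w i (k i)) =
      (fun k => ∏ i, w i (k i)) +
        ((Complex.exp (α * Complex.I) - 1) * Real.cos (θ / 2) ^ N) •
          fun k => ∏ i, (fun _ => Pi.single 0 1 : Fin N → Fin 2 → ℂ) i (k i) := by
    ext k
    rw [zeroPhaseGate, Matrix.mulVec_diagonal, Pi.add_apply, Pi.smul_apply, smul_eq_mul]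
    by_cases hk : k = 0
    · simp [hk, hw0]
      ring
    · obtain ⟨i, hi⟩ := Function.ne_iff.1 hk
      have h0 : ∏ i, (Pi.single 0 1 : Fin 2 → ℂ) (k i) = 0 :=
        Finset.prod_eq_zero (Finset.mem_univ i) (Pi.single_eq_of_ne hi _)
      rw [if_neg hk, h0]
      ring
  -- The sign carried by the state cancels the sign in row `x i` of the Hadamard gate; hence the
  -- independence of `x`.
  have hsq : ∀ i, ((-1 : ℂ) ^ (x i : ℕ)) * (-1) ^ (x i : ℕ) = 1 := fun i => by
    rw [← mul_pow]
    simp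
  have hrow : ∀ (j : Fin 2) (u : Fin 2 → ℂ), (hadamard *ᵥ u) j =
      ((1 / Real.sqrt 2 : ℝ) : ℂ) * (u 0 + (-1) ^ (j : ℕ) * u 1) := fun j u => by
    fin_cases j <;> simp [hadamard, Matrix.mulVec, dotProduct, Fin.sum_univ_two] <;> ring
  have hterm : ∀ i, (hadamard *ᵥ w i) (x i) = ((1 / Real.sqrt 2 : ℝ) : ℂ) *
      (Real.cos (θ / 2) + Complex.exp (β * Complex.I) * Real.sin (θ / 2)) := fun i => by
    rw [hrow, hw0, hw1]
    linear_combination ((1 / Real.sqrt 2 : ℝ) : ℂ) * Complex.exp (β * Complex.I) *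
      Real.sin (θ / 2) * hsq i
  rw [pbrCircuit, ← Matrix.mulVec_mulVec, ← Matrix.mulVec_mulVec, tensor_mulVec, hsplit,
    Matrix.mulVec_add, Matrix.mulVec_smul, tensor_mulVec, tensor_mulVec]
  simp only [Pi.add_apply, Pi.smul_apply, smul_eq_mul, hterm]
  simp only [hrow, Pi.single_eq_same, Pi.single_eq_of_ne (one_ne_zero : (1 : Fin 2) ≠ 0),
    Finset.prod_const, Finset.card_univ, Fintype.card_fin, mul_zero, add_zero, mul_one, mul_pow]
  ring

end Circuit

/-! ### Admissible angles -/

section Angles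

open scoped ComplexOrder

theorem mem_pbrAngles_iff {N : ℕ} {θ : ℝ} : θ ∈ pbrAngles N ↔ 0 < θ ∧ θ < Real.pi / 2 ∧
    ∃ α β : ℝ, (Real.cos (θ / 2) + Complex.exp (β * Complex.I) * Real.sin (θ / 2)) ^ N
      + (Complex.exp (α * Complex.I) - 1) * Real.cos (θ / 2) ^ N = 0 := by
  have hp : ∀ (α β : ℝ) (x : Fin N → Fin 2),
      quantumCorrelation (pbrState θ) (pbrMeasurement N α β) x x =
        Complex.normSq (((1 / Real.sqrt 2 : ℝ) : ℂ) ^ N *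
        ((Real.cos (θ / 2) + Complex.exp (β * Complex.I) * Real.sin (θ / 2)) ^ N
          + (Complex.exp (α * Complex.I) - 1) * Real.cos (θ / 2) ^ N)) := fun α β x => by
    rw [quantumCorrelation, tensor_pbrState, pbrMeasurement, born_vecMulVec,
      pbrCircuit_mulVec_apply]
  have h2 : ((1 / Real.sqrt 2 : ℝ) : ℂ) ^ N ≠ 0 := by simp
  refine and_congr_right fun _ => and_congr_right fun _ => exists_congr fun α =>
    exists_congr fun β => ?_
  rw [successMetric_unif_eq_one_iff fun x => by rw [hp]; exact Complex.normSq_nonneg _]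
  simp only [hp, Complex.normSq_eq_zero, mul_eq_zero, h2, false_or, forall_const]
  exact and_iff_right (isPOVM_pbrMeasurement N α β)

/-- This is the triangle inequality for the binomial expansion with its term `a ^ n` removed,
obtained by induction. -/
theorem norm_add_pow_sub_pow_le (a b : ℂ) (n : ℕ) :
    ‖(a + b) ^ n - a ^ n‖ ≤ (‖a‖ + ‖b‖) ^ n - ‖a‖ ^ n := by
  induction n with
  | zero => simp
  | succ n ih =>
    calc ‖(a + b) ^ (n + 1) - a ^ (n + 1)‖
        = ‖((a + b) ^ n - a ^ n) * (a + b) + a ^ n * b‖ := by ring_nf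
      _ ≤ ‖(a + b) ^ n - a ^ n‖ * ‖a + b‖ + ‖a‖ ^ n * ‖b‖ := by
        refine (norm_add_le _ _).trans_eq ?_
        rw [norm_mul, norm_mul, norm_pow]
      _ ≤ ((‖a‖ + ‖b‖) ^ n - ‖a‖ ^ n) * (‖a‖ + ‖b‖) + ‖a‖ ^ n * ‖b‖ := by
        gcongr
        · exact (norm_nonneg _).trans ih
        · exact norm_add_le _ _
      _ = _ := by ring

/-- Circuit parameters that cancel the amplitude exist exactly when `2 c ^ N ≤ (c + s) ^ N`. -/
theorem exists_phases_iff {N : ℕ} {c s : ℝ} (hs : 0 ≤ s) (hsc : s ≤ c) :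
    (∃ α β : ℝ, ((c : ℂ) + Complex.exp (β * Complex.I) * s) ^ N
      + (Complex.exp (α * Complex.I) - 1) * c ^ N = 0) ↔ 2 * c ^ N ≤ (c + s) ^ N := by
  have hc : 0 ≤ c := hs.trans hsc
  constructor
  · rintro ⟨α, β, h⟩
    have h1 : ((c : ℂ) + Complex.exp (β * Complex.I) * s) ^ N - c ^ N =
        -(Complex.exp (α * Complex.I) * c ^ N) := by linear_combination h
    have h2 := norm_add_pow_sub_pow_le (c : ℂ) (Complex.exp (β * Complex.I) * s) N
    rw [h1, norm_neg, norm_mul, norm_mul, Complex.norm_exp_ofReal_mul_I,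
      Complex.norm_exp_ofReal_mul_I, norm_pow, Complex.norm_of_nonneg hc,
      Complex.norm_of_nonneg hs, one_mul, one_mul] at h2
    linarith
  · intro h
    -- A suitable `α` exists once `f β = c ^ N`. At `β = 0` the value is `(c + s)^N - c^N ≥ c^N`; at
    -- `β = π` it is `c^N - (c - s)^N ≤ c^N`, by `s ≤ c`.
    set f : ℝ → ℝ := fun β => ‖(c : ℂ) ^ N - ((c : ℂ) + Complex.exp (β * Complex.I) * s) ^ N‖
      with hf
    have hcont : Continuous f := by fun_prop
    have hf0 : c ^ N ≤ f 0 := by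
      have : f 0 = ‖((c ^ N - (c + s) ^ N : ℝ) : ℂ)‖ := by simp [hf]
      rw [this, Complex.norm_real, Real.norm_eq_abs]
      refine le_trans ?_ (neg_le_abs _)
      linarith
    have hfpi : f Real.pi ≤ c ^ N := by
      have : f Real.pi = ‖((c ^ N - (c - s) ^ N : ℝ) : ℂ)‖ := by
        simp [hf, sub_eq_add_neg]
      rw [this, Complex.norm_real, Real.norm_eq_abs]
      have h1 : (c - s) ^ N ≤ c ^ N := pow_le_pow_left₀ (by linarith) (by linarith) N
      have h2 : 0 ≤ (c - s) ^ N := pow_nonneg (by linarith) N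
      rw [abs_of_nonneg] <;> linarith
    obtain ⟨β, -, hβ⟩ := intermediate_value_Icc' Real.pi_pos.le hcont.continuousOn ⟨hfpi, hf0⟩
    refine ⟨Complex.arg ((c : ℂ) ^ N - ((c : ℂ) + Complex.exp (β * Complex.I) * s) ^ N), β, ?_⟩
    have h3 := Complex.norm_mul_exp_arg_mul_I
      ((c : ℂ) ^ N - ((c : ℂ) + Complex.exp (β * Complex.I) * s) ^ N)
    simp only [hf] at hβ
    rw [hβ] at h3
    push_cast at h3
    linear_combination h3

theorem two_rpow_one_div_pow {N : ℕ} (hN : N ≠ 0) : ((2 : ℝ) ^ (1 / (N : ℝ))) ^ N = 2 := by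
  rw [one_div]
  exact Real.rpow_inv_natCast_pow zero_le_two hN

theorem optAngle_pos {N : ℕ} (hN : N ≠ 0) : 0 < optAngle N := by
  have h : (1 : ℝ) < 2 ^ (1 / (N : ℝ)) := Real.one_lt_rpow one_lt_two (by positivity)
  exact mul_pos two_pos (Real.arctan_pos.2 (sub_pos.2 h))

/-- For `N = 1` the angle would equal `π/2`; from `N = 2` on, `2^{1/N} - 1 < 1 = tan(π/4)`. -/
theorem optAngle_lt {N : ℕ} (hN : 2 ≤ N) : optAngle N < Real.pi / 2 := by
  have h1 : (1 : ℝ) / N < 1 := by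
    rw [div_lt_one (by positivity)]
    exact_mod_cast hN
  have h : (2 : ℝ) ^ (1 / (N : ℝ)) < 2 := by
    simpa using Real.rpow_lt_rpow_of_exponent_lt one_lt_two h1
  have := Real.arctan_strictMono (show (2 : ℝ) ^ (1 / (N : ℝ)) - 1 < 1 by linarith)
  rw [Real.arctan_one] at this
  unfold optAngle
  linarith

theorem two_mul_cos_pow_le_iff {N : ℕ} (hN : N ≠ 0) {θ : ℝ} (h0 : 0 < θ)
    (h1 : θ < Real.pi / 2) : 2 * Real.cos (θ / 2) ^ N ≤
      (Real.cos (θ / 2) + Real.sin (θ / 2)) ^ N ↔ optAngle N ≤ θ := by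
  have hc : 0 < Real.cos (θ / 2) := Real.cos_pos_of_mem_Ioo ⟨by linarith, by linarith⟩
  have hs : 0 < Real.sin (θ / 2) := Real.sin_pos_of_pos_of_lt_pi (by linarith) (by linarith)
  have hr : (0 : ℝ) < 2 ^ (1 / (N : ℝ)) := by positivity
  have ht : optAngle N ≤ θ ↔ (2 : ℝ) ^ (1 / (N : ℝ)) - 1 ≤ Real.tan (θ / 2) := by
    rw [← Real.arctan_strictMono.le_iff_le (b := Real.tan (θ / 2)), Real.arctan_tan (by linarith) (by linarith),
      optAngle, le_div_iff₀' two_pos]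
  rw [ht, Real.tan_eq_sin_div_cos, le_div_iff₀ hc]
  nth_rw 1 [← two_rpow_one_div_pow hN]
  rw [← mul_pow, pow_le_pow_iff_left₀ (by positivity) (by positivity) hN]
  constructor <;> intro h <;> linarith

theorem pbrAngles_eq {N : ℕ} (hN : N ≠ 0) :
    pbrAngles N = Set.Ico (optAngle N) (Real.pi / 2) := by
  ext θ
  rw [mem_pbrAngles_iff, Set.mem_Ico]
  have key : 0 < θ → θ < Real.pi / 2 → ((∃ α β : ℝ,
      (Real.cos (θ / 2) + Complex.exp (β * Complex.I) * Real.sin (θ / 2)) ^ N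
      + (Complex.exp (α * Complex.I) - 1) * Real.cos (θ / 2) ^ N = 0) ↔ optAngle N ≤ θ) := by
    intro h0 h1
    rw [exists_phases_iff, two_mul_cos_pow_le_iff hN h0 h1]
    · exact (Real.sin_pos_of_pos_of_lt_pi (by linarith) (by linarith)).le
    · rw [← Real.sin_pi_div_two_sub]
      exact Real.sin_le_sin_of_le_of_le_pi_div_two (by linarith) (by linarith) (by linarith)
  constructor
  · rintro ⟨h0, h1, h⟩
    exact ⟨(key h0 h1).1 h, h1⟩
  · rintro ⟨h, h1⟩
    have h0 := (optAngle_pos hN).trans_le h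
    exact ⟨h0, h1, (key h0 h1).2 h⟩

end Angles

/-! ### Optimality and asymptotics -/

section Advantage

/-- The numerator is constantly 1 and `sin` increases on this interval. Strictness yields uniqueness
of the maximiser as well as optimality. -/
theorem pbrAdvantage_strictAntiOn {N : ℕ} (hN : N ≠ 0) :
    StrictAntiOn (pbrAdvantage N) (Set.Ioo 0 (Real.pi / 2)) := by
  intro θ hθ φ hφ h
  have h1 : 0 < Real.sin θ := Real.sin_pos_of_pos_of_lt_pi hθ.1 (by linarith [hθ.2, Real.pi_pos])
  have h2 : Real.sin θ < Real.sin φ :=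
    Real.sin_lt_sin_of_lt_of_le_pi_div_two (by linarith [hθ.1, Real.pi_pos]) hφ.2.le h
  have h3 := h1.trans h2
  rw [pbrAdvantage, pbrAdvantage, requiredClassical_eq_one hN, pbrQuantum_eq h1.le,
    pbrQuantum_eq h3.le]
  refine pow_lt_pow_left₀ ?_ (by positivity) hN
  exact one_div_lt_one_div_of_lt (by positivity) (by linarith)

theorem sin_two_mul_arctan (t : ℝ) : Real.sin (2 * Real.arctan t) = 2 * t / (1 + t ^ 2) := by
  rw [Real.sin_two_mul, Real.sin_arctan, Real.cos_arctan, mul_assoc, div_mul_div_comm, mul_one,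
    Real.mul_self_sqrt (by positivity), mul_div_assoc]

theorem requiredClassical_div_pbrQuantum_optAngle {N : ℕ} (hN : N ≠ 0) :
    requiredClassical N / pbrQuantum (optAngle N) =
      2 * (1 + (2 : ℝ) ^ (1 - 2 / (N : ℝ)) - (2 : ℝ) ^ (1 - 1 / (N : ℝ))) := by
  have hr : (1 : ℝ) < 2 ^ (1 / (N : ℝ)) := Real.one_lt_rpow one_lt_two (by positivity)
  have e1 : (2 : ℝ) ^ (1 - 1 / (N : ℝ)) = 2 / 2 ^ (1 / (N : ℝ)) := by
    rw [Real.rpow_sub two_pos, Real.rpow_one]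
  have e2 : (2 : ℝ) ^ (1 - 2 / (N : ℝ)) = 2 / (2 ^ (1 / (N : ℝ))) ^ 2 := by
    rw [Real.rpow_sub two_pos, Real.rpow_one, ← Real.rpow_mul_natCast zero_le_two]
    congr 2
    push_cast
    ring
  have hs : Real.sin (optAngle N) = _ := sin_two_mul_arctan _
  rw [e1, e2]
  generalize (2 : ℝ) ^ (1 / (N : ℝ)) = r at hr hs
  have hp : 0 < 1 + (r - 1) ^ 2 := by positivity
  rw [requiredClassical_eq_one hN, pbrQuantum_eq, hs]
  · have h1 : 1 + 2 * (r - 1) / (1 + (r - 1) ^ 2) = r ^ 2 / (1 + (r - 1) ^ 2) := by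
      field_simp
      ring
    rw [h1]
    have : r ≠ 0 := by linarith
    field_simp
    ring
  · rw [hs]
    have : 0 < r - 1 := sub_pos.2 hr
    positivity

/-- This is the derivative at `u = 0` of `2^(1 - 2u) - 2^(1 - u)`, which vanishes there, sampled
along `u = 1/N`. -/
theorem tendsto_natCast_mul_rpow_sub_rpow :
    Filter.Tendsto (fun N : ℕ => (N : ℝ) *
      ((2 : ℝ) ^ (1 - 2 / (N : ℝ)) - (2 : ℝ) ^ (1 - 1 / (N : ℝ)))) Filter.atTop
      (nhds (-(2 * Real.log 2))) := by
  have h1 : HasDerivAt (fun u : ℝ => (2 : ℝ) ^ (1 - 2 * u)) (-(4 * Real.log 2)) 0 := by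
    convert (((hasDerivAt_id' (0 : ℝ)).const_mul 2).const_sub 1).const_rpow (a := 2) two_pos
      using 1
    norm_num
    ring
  have h2 : HasDerivAt (fun u : ℝ => (2 : ℝ) ^ (1 - u)) (-(2 * Real.log 2)) 0 := by
    convert ((hasDerivAt_id' (0 : ℝ)).const_sub 1).const_rpow (a := 2) two_pos using 1
    norm_num
    ring
  have h3 := (h1.sub h2).hasFDerivAt.lim 1 (c := fun N : ℕ => (N : ℝ)) (l := Filter.atTop)
    (by simpa using tendsto_natCast_atTop_atTop (R := ℝ))
  convert h3 using 2
  · simp [div_eq_mul_inv]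
  · simp
    ring

theorem tendsto_rpow_pow :
    Filter.Tendsto (fun N : ℕ =>
      (1 + (2 : ℝ) ^ (1 - 2 / (N : ℝ)) - (2 : ℝ) ^ (1 - 1 / (N : ℝ))) ^ N) Filter.atTop
      (nhds (1 / 4)) := by
  have h := Real.tendsto_one_add_pow_exp_of_tendsto tendsto_natCast_mul_rpow_sub_rpow
  have he : Real.exp (-(2 * Real.log 2)) = 1 / 4 := by
    rw [Real.exp_neg, mul_comm, Real.exp_mul, Real.exp_log two_pos]
    norm_num
  rw [he] at h
  simpa only [add_sub_assoc] using h

theorem tendsto_requiredClassical_div_pbrQuantum :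
    Filter.Tendsto (fun N : ℕ => requiredClassical N / pbrQuantum (optAngle N)) Filter.atTop
      (nhds 2) := by
  have h := (tendsto_natCast_mul_rpow_sub_rpow.mul
    (tendsto_inv_atTop_nhds_zero_nat (𝕜 := ℝ))).const_add 1 |>.const_mul 2
  rw [mul_zero, add_zero, mul_one] at h
  refine h.congr' ?_
  filter_upwards [Filter.eventually_ne_atTop 0] with N hN
  rw [requiredClassical_div_pbrQuantum_optAngle hN]
  have : (N : ℝ) ≠ 0 := Nat.cast_ne_zero.2 hN
  field_simp
  ring

theorem pbrAdvantage_optAngle {N : ℕ} (hN : N ≠ 0) :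
    pbrAdvantage N (optAngle N) = (2 : ℝ) ^ N *
      (1 + (2 : ℝ) ^ (1 - 2 / (N : ℝ)) - (2 : ℝ) ^ (1 - 1 / (N : ℝ))) ^ N := by
  rw [pbrAdvantage, requiredClassical_div_pbrQuantum_optAngle hN, mul_pow]

theorem tendsto_pbrAdvantage_div_two_pow :
    Filter.Tendsto (fun N : ℕ => pbrAdvantage N (optAngle N) / (2 : ℝ) ^ N) Filter.atTop
      (nhds (1 / 4)) := by
  refine tendsto_rpow_pow.congr' ?_
  filter_upwards [Filter.eventually_ne_atTop 0] with N hN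
  rw [pbrAdvantage_optAngle hN, mul_div_cancel_left₀ _ (by positivity)]

end Advantage

end DistributedAnti

theorem mainTheorem3 :
    (∀ N : ℕ, 2 ≤ N →
      DistributedAnti.pbrAngles N =
        Set.Ico (DistributedAnti.optAngle N) (Real.pi / 2) ∧
      DistributedAnti.optAngle N ∈ DistributedAnti.pbrAngles N ∧
      (∀ θ ∈ DistributedAnti.pbrAngles N,
        DistributedAnti.pbrAdvantage N θ ≤
          DistributedAnti.pbrAdvantage N (DistributedAnti.optAngle N)) ∧
      (∀ θ ∈ DistributedAnti.pbrAngles N,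
        DistributedAnti.pbrAdvantage N θ =
          DistributedAnti.pbrAdvantage N (DistributedAnti.optAngle N) →
        θ = DistributedAnti.optAngle N) ∧
      DistributedAnti.pbrAdvantage N (DistributedAnti.optAngle N) =
        (2 : ℝ) ^ N *
          (1 + (2 : ℝ) ^ (1 - 2 / (N : ℝ)) - (2 : ℝ) ^ (1 - 1 / (N : ℝ))) ^ N) ∧
    Filter.Tendsto
      (fun N : ℕ => DistributedAnti.requiredClassical N /
        DistributedAnti.pbrQuantum (DistributedAnti.optAngle N))
      Filter.atTop (nhds 2) ∧
    Asymptotics.IsTheta Filter.atTop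
      (fun N : ℕ => DistributedAnti.pbrAdvantage N (DistributedAnti.optAngle N))
      (fun N : ℕ => (2 : ℝ) ^ N) ∧
    Filter.Tendsto
      (fun N : ℕ =>
        DistributedAnti.pbrAdvantage N (DistributedAnti.optAngle N) / (2 : ℝ) ^ N)
      Filter.atTop (nhds (1 / 4)) := by
  refine ⟨fun N hN => ?_, DistributedAnti.tendsto_requiredClassical_div_pbrQuantum,
    (Asymptotics.isTheta_of_div_tendsto_nhds_ne_zero
      DistributedAnti.tendsto_pbrAdvantage_div_two_pow (by norm_num)).symm,
    DistributedAnti.tendsto_pbrAdvantage_div_two_pow⟩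
  have hN0 : N ≠ 0 := by omega
  have hpos := DistributedAnti.optAngle_pos hN0
  have hlt := DistributedAnti.optAngle_lt hN
  have hanti := DistributedAnti.pbrAdvantage_strictAntiOn hN0
  rw [DistributedAnti.pbrAngles_eq hN0]
  refine ⟨rfl, ⟨le_rfl, hlt⟩, fun θ hθ => ?_, fun θ hθ h => ?_,
    DistributedAnti.pbrAdvantage_optAngle hN0⟩
  · exact hanti.antitoneOn ⟨hpos, hlt⟩ ⟨hpos.trans_le hθ.1, hθ.2⟩ hθ.1
  · exact hanti.injOn ⟨hpos.trans_le hθ.1, hθ.2⟩ ⟨hpos, hlt⟩ h
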